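/- Let $k$ be a complete non-Archimedean valued field (the trivial absolute value is allowed), let $n\ge 0$ and $\mathbf r=(r_1,\dots,r_n)\in(\mathbb R_{>0})^n$. Let $\mathbb D_{\mathbf r}$ be the closed $k$-polydisc of polyradius $\mathbf r$ centred at the origin (in the sense of Berkovich), with coordinate functions $T_1,\dots,T_n$, and let $\mathcal A_{\mathbf r}=\{\sum_I a_IT^I : |a_I|\,\mathbf r^I\to 0\}$ be its algebra of analytic functions, with the spectral norm $\|f\|_\infty=\sup_{x\in\mathbb D_{\mathbf r}}|f(x)|$. For a ring $R$ with a non-Archimedean seminorm $\|\cdot\|$, let $\widetilde R=\bigoplus_{\rho>0}\widetilde R_\rho$ with $\widetilde R_\rho=\{\|a\|\le\rho\}/\{\|a\|<\rho\}$ be its graded reduction, and for $a\in R$ with $\|a\|>0$ let $\widetilde a$ be the class of $a$ in degree $\|a\|$. Apply this to $k$ with its absolute value and to $\mathcal A_{\mathbf r}$ with $\|\cdot\|_\infty$; then $\widetilde{\mathcal A_{\mathbf r}}$ is a $\widetilde k$-algebra. Write $\tau_j=\widetilde{T_j}$, which is homogeneous of degree $r_j$. Let $f_1,\dots,f_n\in\mathcal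 A_{\mathbf r}$ be nonzero and put $s_i=\|f_i\|_\infty>0$, $\mathbf s=(s_1,\dots,s_n)$. Suppose that there are a matrix $A=(a_{ij})$ with $a_{ij}\in\widetilde k_{s_ir_j^{-1}}$ and $\det A\ne 0$ (that is, $A\in\mathrm{GL}(\widetilde k,\mathbf s,\mathbf r)$) and a vector $B=(b_i)$ with $b_i\in\widetilde k_{s_i}$ such that $$\widetilde{f_i}=\sum_{j=1}^n a_{ij}\tau_j+b_i\qquad(1\le i\le n)$$ in $\widetilde{\mathcal A_{\mathbf r}}$. Then $(f_1,\dots,f_n)$ is a coordinate system on $\mathbb D_{\mathbf r}$ (that is, the $f_i$ induce an isomorphism of $\mathbb D_{\mathbf r}$ onto some closed $k$-polydisc centred at the origin); more precisely, there is a unique morphism of $k$-analytic spaces $\varphi:\mathbb D_{\mathbf r}\to\mathbb D_{\mathbf s}$ with $\varphi^*T_i=f_i$ for all $i$, and $\varphi$ is an isomorphism. -/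

import Mathlib

noncomputable section

namespace Polydisc

/-- The multiplicative group of positive real numbers, in which degrees live. -/
abbrev PosReal : Type := {x : ℝ // 0 < x}

/-! ### Graded reduction of a seminormed ring -/

/-- A non-Archimedean (submultiplicative) seminorm on a commutative ring. -/
structure NonarchSeminorm (A : Type*) [CommRing A] extends RingSeminorm A where
  add_le_max' : ∀ a b : A, toFun (a + b) ≤ max (toFun a) (toFun b)
  one_le' : toFun 1 ≤ 1

namespace NonarchSeminorm

variable {A B : Type*} [CommRing A] [CommRing B]

instance : CoeFun (NonarchSeminorm A) (fun _ => A → ℝ) := ⟨fun N => N.toFun⟩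

theorem nonneg (N : NonarchSeminorm A) (a : A) : 0 ≤ N a :=
  apply_nonneg N.toRingSeminorm a

/-- The Rees ring `⨁_ρ {a | N a ≤ ρ}`, inside the group ring of `PosReal` over `A`. -/
def rees (N : NonarchSeminorm A) : Subring (MonoidAlgebra A PosReal) where
  carrier := {p | ∀ ρ : PosReal, N (p.coeff ρ) ≤ (ρ : ℝ)}
  zero_mem' := fun ρ => by
    have h : N (0 : A) = 0 := N.map_zero'
    simpa [h] using ρ.2.le
  add_mem' := fun {p q} hp hq ρ => by
    simpa using (N.add_le_max' (p.coeff ρ) (q.coeff ρ)).trans (max_le (hp ρ) (hq ρ))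
  neg_mem' := fun {p} hp ρ => by
    have h : N (-p.coeff ρ) = N (p.coeff ρ) := N.neg' _
    simpa [h] using hp ρ
  one_mem' := fun ρ => by
    classical
    have h : N (0 : A) = 0 := N.map_zero'
    rw [MonoidAlgebra.one_def, MonoidAlgebra.coeff_single, Finsupp.single_apply]
    split_ifs with h1
    · rw [← h1]; exact N.one_le'
    · rw [h]; exact ρ.2.le
  mul_mem' := fun {p q} hp hq ρ => by
    classical
    have hz : N (0 : A) = 0 := N.map_zero'
    rw [MonoidAlgebra.coeff_mul]
    simp only [Finsupp.sum]
    have key : ∀ (ι : Type) (t : Finset ι) (F : ι → A), (∀ i ∈ t, N (F i) ≤ (ρ : ℝ)) →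
        N (∑ i ∈ t, F i) ≤ (ρ : ℝ) := by
      intro ι t F
      induction t using Finset.induction_on with
      | empty => intro _; simpa [hz] using ρ.2.le
      | insert a t ha ih =>
        intro hF
        rw [Finset.sum_insert ha]
        exact (N.add_le_max' _ _).trans (max_le (hF a (Finset.mem_insert_self a t))
          (ih fun i hi => hF i (Finset.mem_insert_of_mem hi)))
    refine key _ _ _ fun a _ => key _ _ _ fun b _ => ?_
    split_ifs with hab
    · rw [← hab]
      exact (N.mul_le' _ _).trans (mul_le_mul (hp a) (hq b) (N.nonneg _) a.2.le)
    · rw [hz]; exact ρ.2.le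

/-- The ideal `⨁_ρ {a | N a < ρ}` of the Rees ring. -/
def reesIdeal (N : NonarchSeminorm A) : Ideal N.rees where
  carrier := {p | ∀ ρ : PosReal, N ((p : MonoidAlgebra A PosReal).coeff ρ) < (ρ : ℝ)}
  zero_mem' := fun ρ => by
    have h : N (0 : A) = 0 := N.map_zero'
    simpa [h] using ρ.2
  add_mem' := fun {p q} hp hq ρ => by
    simpa using (N.add_le_max' (p.1.coeff ρ) (q.1.coeff ρ)).trans_lt (max_lt (hp ρ) (hq ρ))
  smul_mem' := fun p q hq ρ => by
    classical
    have hz : N (0 : A) = 0 := N.map_zero'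
    rw [smul_eq_mul, Subring.coe_mul, MonoidAlgebra.coeff_mul]
    simp only [Finsupp.sum]
    have key : ∀ (ι : Type) (t : Finset ι) (F : ι → A), (∀ i ∈ t, N (F i) < (ρ : ℝ)) →
        N (∑ i ∈ t, F i) < (ρ : ℝ) := by
      intro ι t F
      induction t using Finset.induction_on with
      | empty => intro _; simpa [hz] using ρ.2
      | insert a t ha ih =>
        intro hF
        rw [Finset.sum_insert ha]
        exact (N.add_le_max' _ _).trans_lt (max_lt (hF a (Finset.mem_insert_self a t))
          (ih fun i hi => hF i (Finset.mem_insert_of_mem hi)))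
    refine key _ _ _ fun a _ => key _ _ _ fun b _ => ?_
    split_ifs with hab
    · rw [← hab]
      exact (N.mul_le' _ _).trans_lt (mul_lt_mul' (p.2 a) (hq b) (N.nonneg _) a.2)
    · rw [hz]; exact ρ.2

/-- The graded reduction `⨁_ρ {a | N a ≤ ρ} / {a | N a < ρ}`, with `ρ` running over the positive
real numbers. -/
def Reduction (N : NonarchSeminorm A) : Type _ := N.rees ⧸ N.reesIdeal

instance (N : NonarchSeminorm A) : CommRing N.Reduction :=
  inferInstanceAs (CommRing (N.rees ⧸ N.reesIdeal))

/-- The quotient map from the Rees ring to the graded reduction. -/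
def toReduction (N : NonarchSeminorm A) : N.rees →+* N.Reduction := Ideal.Quotient.mk N.reesIdeal

/-- The element `a` placed in degree `ρ` of the Rees ring. -/
def reesSingle (N : NonarchSeminorm A) (ρ : PosReal) (a : A) (h : N a ≤ (ρ : ℝ)) : N.rees :=
  ⟨MonoidAlgebra.single ρ a, fun σ => by
    classical
    have hz : N (0 : A) = 0 := N.map_zero'
    rw [MonoidAlgebra.coeff_single, Finsupp.single_apply]
    split_ifs with h1
    · rw [← h1]; exact h
    · rw [hz]; exact σ.2.le⟩

/-- The class of `a` in the degree `ρ` part of the graded reduction, for `N a ≤ ρ`. -/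
def residue (N : NonarchSeminorm A) (ρ : PosReal) (a : A) (h : N a ≤ (ρ : ℝ)) : N.Reduction :=
  N.toReduction (N.reesSingle ρ a h)

/-- The group of homogeneous elements of degree `ρ` of the graded reduction. -/
def homogeneousPart (N : NonarchSeminorm A) (ρ : PosReal) : AddSubgroup N.Reduction where
  carrier := {x | ∃ (a : A) (h : N a ≤ (ρ : ℝ)), x = N.residue ρ a h}
  zero_mem' := by
    have hz : N (0 : A) = 0 := N.map_zero'
    refine ⟨0, by rw [hz]; exact ρ.2.le, ?_⟩
    have : N.reesSingle ρ 0 (by rw [hz]; exact ρ.2.le) = 0 :=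
      Subtype.ext (MonoidAlgebra.single_zero ρ)
    rw [residue, this, map_zero]
  add_mem' := by
    rintro _ _ ⟨a, ha, rfl⟩ ⟨b, hb, rfl⟩
    have hab : N (a + b) ≤ (ρ : ℝ) := (N.add_le_max' a b).trans (max_le ha hb)
    refine ⟨a + b, hab, ?_⟩
    have : N.reesSingle ρ (a + b) hab = N.reesSingle ρ a ha + N.reesSingle ρ b hb :=
      Subtype.ext (MonoidAlgebra.single_add ρ a b)
    rw [residue, residue, residue, this, map_add]
  neg_mem' := by
    rintro _ ⟨a, ha, rfl⟩
    have hna : N (-a) ≤ (ρ : ℝ) := (N.neg' a).le.trans ha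
    refine ⟨-a, hna, ?_⟩
    have : N.reesSingle ρ (-a) hna = - N.reesSingle ρ a ha :=
      Subtype.ext (MonoidAlgebra.single_neg ρ a)
    rw [residue, residue, this, map_neg]

open Classical in
/-- The graded reduction of an element `a`: its class in degree `N a` (and `0` if `N a = 0`). -/
def reduce (N : NonarchSeminorm A) (a : A) : N.Reduction :=
  if h : 0 < N a then N.residue ⟨N a, h⟩ a le_rfl else 0

/-- The ring homomorphism between Rees rings induced by a norm-nonincreasing homomorphism. -/
def reesMap (N : NonarchSeminorm A) (M : NonarchSeminorm B) (φ : A →+* B)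
    (h : ∀ a, M (φ a) ≤ N a) : N.rees →+* M.rees :=
  ((MonoidAlgebra.mapRingHom PosReal φ).comp N.rees.subtype).codRestrict M.rees
    (fun p ρ => by
      simpa using (h _).trans (p.2 ρ))

/-- The graded ring homomorphism between graded reductions induced by a norm-nonincreasing
homomorphism. -/
def reductionMap (N : NonarchSeminorm A) (M : NonarchSeminorm B) (φ : A →+* B)
    (h : ∀ a, M (φ a) ≤ N a) : N.Reduction →+* M.Reduction :=
  Ideal.quotientMap M.reesIdeal (reesMap N M φ h) (fun p hp ρ => by
    change M (((MonoidAlgebra.mapRingHom PosReal φ) p.1).coeff ρ) < (ρ : ℝ)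
    simpa using (h _).trans_lt (hp ρ))

/-- The homogeneous matrices `(a_ij)` with `a_ij` of degree `s_i / r_j` and nonzero determinant. -/
def homogeneousGL (N : NonarchSeminorm A) {n : ℕ} (s r : Fin n → PosReal) :
    Set (Matrix (Fin n) (Fin n) N.Reduction) :=
  {M | (∀ i j, M i j ∈ N.homogeneousPart (s i / r j)) ∧ M.det ≠ 0}

end NonarchSeminorm

/-! ### Closed polydiscs in the sense of Berkovich -/

variable (k : Type*) [NormedField k] [IsUltrametricDist k]

/-- The absolute value of `k`. -/
def absSeminorm : NonarchSeminorm k where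
  toFun := fun a => ‖a‖
  map_zero' := norm_zero
  add_le' := norm_add_le
  neg' := norm_neg
  mul_le' := fun a b => (norm_mul a b).le
  add_le_max' := IsUltrametricDist.norm_add_le_max
  one_le' := norm_one.le

variable {n m : ℕ}

/-- The algebra of analytic functions on the closed polydisc of polyradius `r`: the power series
`∑ a_I T^I` such that `|a_I| r^I` tends to `0`. -/
def Functions (r : Fin n → PosReal) : Subalgebra k (MvPowerSeries (Fin n) k) where
  __ := MvPowerSeries.IsRestricted.subring (R := k) (fun i => (r i : ℝ))
  algebraMap_mem' := fun a => MvPowerSeries.isRestricted_C (fun i => (r i : ℝ)) a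

variable {k}

/-- The Banach norm `max_I |a_I| r^I` on the algebra of analytic functions. -/
def gaussNorm {r : Fin n → PosReal} (f : Functions k r) : ℝ :=
  MvPowerSeries.gaussNorm (fun a : k => ‖a‖) (fun i => (r i : ℝ)) (f : MvPowerSeries (Fin n) k)

variable (k)

/-- The coordinate function `T_i` on the closed polydisc. -/
def coordinate (r : Fin n → PosReal) (i : Fin n) : Functions k r :=
  ⟨MvPowerSeries.X i, MvPowerSeries.isRestricted_monomial (fun i => (r i : ℝ)) _ _⟩

/-- The closed polydisc of polyradius `r` centred at the origin, i.e. the Berkovich spectrum of its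
algebra of analytic functions: its points are the bounded multiplicative seminorms. -/
structure Space (r : Fin n → PosReal) extends MulRingSeminorm (Functions k r) where
  le_gaussNorm' : ∀ f, toFun f ≤ gaussNorm f
  add_le_max' : ∀ f g, toFun (f + g) ≤ max (toFun f) (toFun g)

variable {k}

/-- The absolute value `|f(x)|` of an analytic function `f` at a point `x`. -/
def absAt {r : Fin n → PosReal} (x : Space k r) (f : Functions k r) : ℝ := x.toFun f

/-- The coarsest topology for which all the functions `x ↦ |f(x)|` are continuous. -/
instance (r : Fin n → PosReal) : TopologicalSpace (Space k r) :=
  TopologicalSpace.induced (fun x f => absAt x f) inferInstance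

theorem absAt_nonneg {r : Fin n → PosReal} (x : Space k r) (f : Functions k r) : 0 ≤ absAt x f :=
  apply_nonneg x.toMulRingSeminorm f

theorem bddAbove_absAt {r : Fin n → PosReal} (f : Functions k r) :
    BddAbove (Set.range fun x : Space k r => absAt x f) :=
  ⟨gaussNorm f, by rintro _ ⟨x, rfl⟩; exact x.le_gaussNorm' f⟩

variable (k)

/-- The spectral norm `‖f‖_∞ = sup_x |f(x)|`. -/
def spectralNorm (r : Fin n → PosReal) : NonarchSeminorm (Functions k r) where
  toFun := fun f => ⨆ x : Space k r, absAt x f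
  map_zero' := by
    have : ∀ x : Space k r, absAt x 0 = 0 := fun x => x.map_zero'
    simp [this]
  add_le' := fun f g =>
    Real.iSup_le (fun x => (x.add_le' f g).trans
      (add_le_add (le_ciSup (bddAbove_absAt f) x) (le_ciSup (bddAbove_absAt g) x)))
      (add_nonneg (Real.iSup_nonneg fun x => absAt_nonneg x f)
        (Real.iSup_nonneg fun x => absAt_nonneg x g))
  neg' := fun f => by
    have : ∀ x : Space k r, absAt x (-f) = absAt x f := fun x => x.neg' f
    simp [this]
  mul_le' := fun f g =>
    Real.iSup_le (fun x => (x.map_mul' f g).le.trans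
      (mul_le_mul (le_ciSup (bddAbove_absAt f) x) (le_ciSup (bddAbove_absAt g) x)
        (absAt_nonneg x g) (Real.iSup_nonneg fun x => absAt_nonneg x f)))
      (mul_nonneg (Real.iSup_nonneg fun x => absAt_nonneg x f)
        (Real.iSup_nonneg fun x => absAt_nonneg x g))
  add_le_max' := fun f g =>
    Real.iSup_le (fun x => (x.add_le_max' f g).trans
      (max_le_max (le_ciSup (bddAbove_absAt f) x) (le_ciSup (bddAbove_absAt g) x)))
      (le_max_of_le_left (Real.iSup_nonneg fun x => absAt_nonneg x f))
  one_le' := Real.iSup_le (fun x => x.map_one'.le) zero_le_one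

theorem spectralNorm_algebraMap_le (r : Fin n → PosReal) (a : k) :
    spectralNorm k r (algebraMap k (Functions k r) a) ≤ absSeminorm k a := by
  classical
  refine Real.iSup_le (fun x => (x.le_gaussNorm' _).trans ?_) (norm_nonneg a)
  refine Real.iSup_le (fun t => ?_) (norm_nonneg a)
  change ‖MvPowerSeries.coeff t (MvPowerSeries.C a)‖ * _ ≤ ‖a‖
  rw [MvPowerSeries.coeff_C]
  split_ifs with h
  · simp [h]
  · simp

/-- The structural homomorphism from the graded reduction of `k` to the graded reduction of the
algebra of analytic functions for the spectral norm. -/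
instance (r : Fin n → PosReal) :
    Algebra (absSeminorm k).Reduction (spectralNorm k r).Reduction :=
  (NonarchSeminorm.reductionMap (absSeminorm k) (spectralNorm k r)
    (algebraMap k (Functions k r)) (spectralNorm_algebraMap_le k r)).toAlgebra

/-- A morphism of `k`-analytic spaces between closed polydiscs: a continuous map together with the
bounded `k`-algebra homomorphism that pulls analytic functions back along it. -/
@[ext]
structure Hom (r : Fin n → PosReal) (s : Fin m → PosReal) where
  toFun : Space k r → Space k s
  pullback : Functions k s →ₐ[k] Functions k r
  continuous_toFun : Continuous toFun
  bounded : ∃ C : ℝ, ∀ g, gaussNorm (pullback g) ≤ C * gaussNorm g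
  absAt_toFun : ∀ x g, absAt (toFun x) g = absAt x (pullback g)

variable {k}

namespace Hom

/-- The identity morphism. -/
def id (r : Fin n → PosReal) : Hom k r r where
  toFun := fun x => x
  pullback := AlgHom.id k _
  continuous_toFun := continuous_id
  bounded := ⟨1, fun g => by simp⟩
  absAt_toFun := fun _ _ => rfl

/-- The composition `ψ ∘ φ` of morphisms. -/
def comp {l : ℕ} {r : Fin n → PosReal} {s : Fin m → PosReal} {t : Fin l → PosReal}
    (ψ : Hom k s t) (φ : Hom k r s) : Hom k r t where
  toFun := fun x => ψ.toFun (φ.toFun x)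
  pullback := φ.pullback.comp ψ.pullback
  continuous_toFun := ψ.continuous_toFun.comp φ.continuous_toFun
  bounded := by
    obtain ⟨C, hC⟩ := φ.bounded
    obtain ⟨D, hD⟩ := ψ.bounded
    have hn : ∀ g : Functions k t, 0 ≤ gaussNorm g := fun g =>
      MvPowerSeries.gaussNorm_nonneg _ _ _ (fun a => norm_nonneg a)
    have hn' : ∀ g : Functions k s, 0 ≤ gaussNorm g := fun g =>
      MvPowerSeries.gaussNorm_nonneg _ _ _ (fun a => norm_nonneg a)
    refine ⟨max C 0 * D, fun g => ?_⟩
    calc gaussNorm (φ.pullback (ψ.pullback g))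
        ≤ C * gaussNorm (ψ.pullback g) := hC _
      _ ≤ max C 0 * gaussNorm (ψ.pullback g) :=
          mul_le_mul_of_nonneg_right (le_max_left _ _) (hn' _)
      _ ≤ max C 0 * (D * gaussNorm g) := mul_le_mul_of_nonneg_left (hD g) (le_max_right _ _)
      _ = max C 0 * D * gaussNorm g := by ring
  absAt_toFun := fun x g => by
    rw [ψ.absAt_toFun, φ.absAt_toFun]; rfl

/-- A morphism is an isomorphism if it has a two-sided inverse morphism. -/
def IsIso {r : Fin n → PosReal} {s : Fin m → PosReal} (φ : Hom k r s) : Prop :=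
  ∃ ψ : Hom k s r, ψ.comp φ = Hom.id r ∧ φ.comp ψ = Hom.id s

end Hom

/-- The functions `f_1, …, f_n` induce an isomorphism from the closed polydisc of polyradius `r` to
the closed polydisc of polyradius `s`: there is one and only one morphism that pulls each
coordinate function `T_i` back to `f_i`, and it is an isomorphism. -/
def InducesIso {r : Fin n → PosReal} (f : Fin n → Functions k r) (s : Fin n → PosReal) : Prop :=
  ∃ φ : Hom k r s, (∀ i, φ.pullback (coordinate k s i) = f i) ∧
    (∀ ψ : Hom k r s, (∀ i, ψ.pullback (coordinate k s i) = f i) → ψ = φ) ∧ φ.IsIso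

/-- The functions `f_1, …, f_n` form a coordinate system: they induce an isomorphism onto some
closed polydisc centred at the origin. -/
def IsCoordinateSystem {r : Fin n → PosReal} (f : Fin n → Functions k r) : Prop :=
  ∃ s : Fin n → PosReal, InducesIso f s

end Polydisc

end

noncomputable section

namespace Polydisc

open Filter Topology

variable {k : Type*} [NormedField k] [IsUltrametricDist k] {n m : ℕ}

/-! ### The Banach algebra of analytic functions -/

/-! The Gauss norm is multiplicative, hence a point of the polydisc, so the spectral norm is the
Gauss norm (`spectralNorm_eq_norm`) and the function algebra is a complete ultrametric algebra.

Lift the graded data to `k`: matrices and vectors with `|a_ij| ≤ s_i / r_j`, `|b_i| ≤ s_i`. The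
identity of reductions says that `f_i` differs from `∑ a_ij T_j + b_i` by norm `< s_i`
(`norm_sub_affine_lt`), and `det A ≠ 0` says that `|det a|` is at least `∏ s_i / ∏ r_j`
(`det_residue_eq_zero`). By Cramer's rule the inverse matrix has entries bounded by `r_i / s_j`
(`exists_inverse_matrix`), so the affine substitution is an isomorphism `L` of function algebras
with inverse `M`, both contractive (`exists_affine_inverse`).

Let `u` be `M` after substitution of `f`. It moves each `T_i` by at most `ε s_i` with one `ε < 1`,
and ultrametricity propagates this to `‖u g - g‖ ≤ ε ‖g‖` for all `g` (`norm_subst_sub_le`). Such a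
`u` is isometric, and surjective by the contraction principle. Hence substitution of `f` is an
isometric isomorphism. A morphism is determined by its pullback, and a bounded pullback by its
values on the coordinates; this gives uniqueness and the inverse morphism. -/

/-- The monomial weight `r^t`. -/
def weight (r : Fin n → PosReal) (t : Fin n →₀ ℕ) : ℝ := t.prod fun i e => (r i : ℝ) ^ e

theorem weight_pos (r : Fin n → PosReal) (t : Fin n →₀ ℕ) : 0 < weight r t :=
  Finset.prod_pos fun i _ => pow_pos (r i).2 _

theorem weight_zero (r : Fin n → PosReal) : weight r 0 = 1 := Finsupp.prod_zero_index

theorem weight_add (r : Fin n → PosReal) (t u : Fin n →₀ ℕ) :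
    weight r (t + u) = weight r t * weight r u :=
  Finsupp.prod_add_index' (fun _ => pow_zero _) fun _ _ _ => pow_add _ _ _

theorem weight_eq_prod (r : Fin n → PosReal) (t : Fin n →₀ ℕ) :
    weight r t = ∏ i, (r i : ℝ) ^ t i :=
  Finsupp.prod_fintype _ _ fun _ => pow_zero _

theorem weight_single (r : Fin n → PosReal) (i : Fin n) : weight r (Finsupp.single i 1) = r i := by
  simp [weight]

namespace Functions

variable {r : Fin n → PosReal}

/-- The coefficient of an analytic function at the monomial `T^t`. -/
def coeff (t : Fin n →₀ ℕ) : Functions k r →ₗ[k] k :=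
  (MvPowerSeries.coeff t).comp (Functions k r).val.toLinearMap

theorem coeff_apply (t : Fin n →₀ ℕ) (f : Functions k r) :
    coeff t f = MvPowerSeries.coeff t (f : MvPowerSeries (Fin n) k) := rfl

theorem ext_coeff {f g : Functions k r} (h : ∀ t, coeff t f = coeff t g) : f = g :=
  Subtype.ext (MvPowerSeries.ext h)

theorem coeff_mul (t : Fin n →₀ ℕ) (f g : Functions k r) :
    coeff t (f * g) = ∑ p ∈ Finset.HasAntidiagonal.antidiagonal t, coeff p.1 f * coeff p.2 g := by
  classical
  exact MvPowerSeries.coeff_mul _ _ _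

theorem tendsto_coeff (f : Functions k r) :
    Tendsto (fun t => ‖coeff t f‖ * weight r t) cofinite (𝓝 0) := f.2

theorem hasGaussNorm (f : Functions k r) :
    MvPowerSeries.HasGaussNorm (fun a : k => ‖a‖) (fun i => (r i : ℝ))
      (f : MvPowerSeries (Fin n) k) :=
  (tendsto_coeff f).bddAbove_range_of_cofinite

theorem isNonarchimedean_norm : IsNonarchimedean fun a : k => ‖a‖ :=
  fun a b => IsUltrametricDist.norm_add_le_max a b

theorem norm_coeff_mul_weight_le_gaussNorm (f : Functions k r) (t : Fin n →₀ ℕ) :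
    ‖coeff t f‖ * weight r t ≤ gaussNorm f :=
  MvPowerSeries.le_gaussNorm _ _ _ (hasGaussNorm f) t

theorem gaussNorm_nonneg (f : Functions k r) : 0 ≤ gaussNorm f :=
  MvPowerSeries.gaussNorm_nonneg _ _ _ fun a => norm_nonneg a

theorem gaussNorm_eq_zero {f : Functions k r} : gaussNorm f = 0 ↔ f = 0 := by
  rw [gaussNorm, MvPowerSeries.gaussNorm_eq_zero_iff _ _ _ norm_zero (fun a => norm_nonneg a)
    (fun x => norm_eq_zero.1) (fun i => (r i).2) (hasGaussNorm f)]
  exact ZeroMemClass.coe_eq_zero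

theorem gaussNorm_add_le_max (f g : Functions k r) :
    gaussNorm (f + g) ≤ max (gaussNorm f) (gaussNorm g) :=
  MvPowerSeries.gaussNorm_add_le_max _ _ _ _ (fun i => (r i).2.le) (fun a => norm_nonneg a)
    isNonarchimedean_norm (hasGaussNorm f) (hasGaussNorm g)

/-- For `f ≠ 0` there is a lexicographically largest exponent at which the Gauss norm of `f` is
achieved. -/
theorem exists_dominant_exponent {f : Functions k r} (hf : f ≠ 0) :
    ∃ i : Fin n →₀ ℕ, ‖coeff i f‖ * weight r i = gaussNorm f ∧
      ∀ t, toLex i < toLex t → ‖coeff t f‖ * weight r t < gaussNorm f := by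
  have hpos : 0 < gaussNorm f :=
    lt_of_le_of_ne (gaussNorm_nonneg f) fun h => hf (gaussNorm_eq_zero.1 h.symm)
  have key : ∀ c : ℝ, 0 < c → {t | c ≤ ‖coeff t f‖ * weight r t}.Finite := fun c hc => by
    have := (tendsto_coeff f).eventually_lt_const hc
    simpa [Filter.eventually_cofinite] using this
  -- The supremum is attained: only finitely many terms reach half of the norm, and a largest one
  -- among them bounds all terms.
  have hne : {t | gaussNorm f ≤ ‖coeff t f‖ * weight r t}.Nonempty := by
    by_contra hempty
    have hlt : ∀ t, ‖coeff t f‖ * weight r t < gaussNorm f := fun t => by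
      by_contra h
      exact hempty ⟨t, not_lt.1 h⟩
    rcases (key (gaussNorm f / 2) (half_pos hpos)).toFinset.eq_empty_or_nonempty with h | h
    · have hle : gaussNorm f ≤ gaussNorm f / 2 := ciSup_le fun t => by
        by_contra ht
        have : t ∈ (key (gaussNorm f / 2) (half_pos hpos)).toFinset := by
          exact (Set.Finite.mem_toFinset _).2 (not_le.1 ht).le
        simp [h] at this
      linarith
    · obtain ⟨u, hu, hmax⟩ := Finset.exists_max_image _
        (fun t => ‖coeff t f‖ * weight r t) h
      have hle : gaussNorm f ≤ ‖coeff u f‖ * weight r u := ciSup_le fun t => by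
        by_cases ht : t ∈ (key (gaussNorm f / 2) (half_pos hpos)).toFinset
        · exact hmax t ht
        · have hu' : gaussNorm f / 2 ≤ ‖coeff u f‖ * weight r u :=
            (Set.Finite.mem_toFinset (key _ (half_pos hpos))).1 hu
          have ht' : ‖coeff t f‖ * weight r t < gaussNorm f / 2 :=
            not_le.1 fun h => ht ((Set.Finite.mem_toFinset _).2 h)
          exact ht'.le.trans hu'
      exact (hlt u).not_ge hle
  obtain ⟨i, hi, hmax⟩ := Set.exists_max_image _ toLex (key _ hpos) hne
  refine ⟨i, le_antisymm (norm_coeff_mul_weight_le_gaussNorm f i) hi, fun t ht => ?_⟩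
  by_contra h
  exact ht.not_ge (hmax t (not_lt.1 h))

/-- The product of the lexicographically last dominant terms cannot be cancelled: in any other pair
of exponents with the same sum, one exponent lies beyond the dominant one, and its term is strictly
smaller. -/
theorem gaussNorm_mul (f g : Functions k r) : gaussNorm (f * g) = gaussNorm f * gaussNorm g := by
  classical
  rcases eq_or_ne f 0 with rfl | hf
  · rw [zero_mul, gaussNorm_eq_zero.2 rfl, zero_mul]
  rcases eq_or_ne g 0 with rfl | hg
  · rw [mul_zero, gaussNorm_eq_zero.2 rfl, mul_zero]
  obtain ⟨i, hi, hi'⟩ := exists_dominant_exponent hf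
  obtain ⟨j, hj, hj'⟩ := exists_dominant_exponent hg
  have hg0 : 0 < gaussNorm g :=
    lt_of_le_of_ne (gaussNorm_nonneg g) fun h => hg (gaussNorm_eq_zero.1 h.symm)
  have hf0 : 0 < gaussNorm f :=
    lt_of_le_of_ne (gaussNorm_nonneg f) fun h => hf (gaussNorm_eq_zero.1 h.symm)
  refine MvPowerSeries.gaussNorm_mul_eq_mul _ _ _ _ (hasGaussNorm f) (hasGaussNorm g)
    (hasGaussNorm (f * g)) (fun a => norm_nonneg a) norm_zero isNonarchimedean_norm norm_mul
    norm_neg (fun x => norm_eq_zero.1) (fun i => (r i).2) ⟨i, j, hi, hj, fun p hp hne => ?_⟩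
  rw [Finset.HasAntidiagonal.mem_antidiagonal] at hp
  change ‖coeff p.1 f * coeff p.2 g‖ < ‖coeff i f‖ * ‖coeff j g‖
  have hw : weight r p.1 * weight r p.2 = weight r i * weight r j := by
    rw [← weight_add, ← weight_add, hp]
  have hlt : (‖coeff p.1 f‖ * weight r p.1) * (‖coeff p.2 g‖ * weight r p.2) <
      gaussNorm f * gaussNorm g := by
    rcases lt_trichotomy (toLex i) (toLex p.1) with h | h | h
    · exact mul_lt_mul_of_lt_of_le_of_nonneg_of_pos (hi' _ h)
        (norm_coeff_mul_weight_le_gaussNorm g _)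
        (mul_nonneg (norm_nonneg _) (weight_pos r _).le) hg0
    · exact absurd (Prod.ext (toLex.injective h).symm (by
        have h1 : i = p.1 := toLex.injective h
        rw [← h1] at hp
        exact add_left_cancel hp)) hne
    · have h2 : toLex j < toLex p.2 := by
        by_contra hcon
        have : toLex p.1 + toLex p.2 < toLex i + toLex j :=
          add_lt_add_of_lt_of_le h (not_lt.1 hcon)
        rw [← toLex_add, ← toLex_add, hp] at this
        exact lt_irrefl _ this
      exact mul_lt_mul' (norm_coeff_mul_weight_le_gaussNorm f _)
        (hj' _ h2) (mul_nonneg (norm_nonneg _) (weight_pos r _).le) hf0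
  rw [← hi, ← hj] at hlt
  have hpos := mul_pos (weight_pos r i) (weight_pos r j)
  refine lt_of_mul_lt_mul_right ?_ hpos.le
  rw [norm_mul]
  calc _ = (‖coeff p.1 f‖ * weight r p.1) * (‖coeff p.2 g‖ * weight r p.2) := by
        rw [← hw]; ring
    _ < _ := hlt
    _ = _ := by ring

theorem coeff_algebraMap (a : k) (t : Fin n →₀ ℕ) :
    coeff t (algebraMap k (Functions k r) a) = if t = 0 then a else 0 := by
  classical
  exact (MvPowerSeries.coeff_C t a).trans (by congr)

theorem gaussNorm_algebraMap (a : k) : gaussNorm (algebraMap k (Functions k r) a) = ‖a‖ := by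
  refine le_antisymm (Real.iSup_le (fun t => ?_) (norm_nonneg a)) ?_
  · change ‖coeff t (algebraMap k (Functions k r) a)‖ * weight r t ≤ ‖a‖
    rw [coeff_algebraMap]
    split_ifs with h
    · simp [h, weight_zero]
    · simp
  · have := norm_coeff_mul_weight_le_gaussNorm (algebraMap k (Functions k r) a) 0
    simpa [coeff_algebraMap, weight_zero] using this

/-- The Gauss norm as a ring norm. -/
def gaussRingNorm (r : Fin n → PosReal) : RingNorm (Functions k r) where
  toFun := gaussNorm
  map_zero' := gaussNorm_eq_zero.2 rfl
  add_le' f g := (gaussNorm_add_le_max f g).trans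
    (max_le_add_of_nonneg (gaussNorm_nonneg f) (gaussNorm_nonneg g))
  neg' _ := MvPowerSeries.gaussNorm_neg _ _ norm_neg _
  mul_le' f g := (gaussNorm_mul f g).le
  eq_zero_of_map_eq_zero' _ := gaussNorm_eq_zero.1

instance : NormedCommRing (Functions k r) where
  __ := (gaussRingNorm r).toNormedRing
  mul_comm := mul_comm

theorem norm_eq_gaussNorm (f : Functions k r) : ‖f‖ = gaussNorm f := rfl

theorem norm_mul' (f g : Functions k r) : ‖f * g‖ = ‖f‖ * ‖g‖ := gaussNorm_mul f g

instance : NormOneClass (Functions k r) where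
  norm_one := by
    rw [← map_one (algebraMap k (Functions k r)), norm_eq_gaussNorm, gaussNorm_algebraMap,
      norm_one]

instance : IsUltrametricDist (Functions k r) :=
  IsUltrametricDist.isUltrametricDist_of_isNonarchimedean_norm gaussNorm_add_le_max

theorem norm_algebraMap_eq (a : k) : ‖algebraMap k (Functions k r) a‖ = ‖a‖ :=
  gaussNorm_algebraMap a

theorem norm_smul_eq (a : k) (f : Functions k r) : ‖a • f‖ = ‖a‖ * ‖f‖ := by
  rw [Algebra.smul_def, norm_mul', norm_algebraMap_eq]

theorem norm_coeff_mul_weight_le (f : Functions k r) (t : Fin n →₀ ℕ) :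
    ‖coeff t f‖ * weight r t ≤ ‖f‖ := norm_coeff_mul_weight_le_gaussNorm f t

theorem norm_le {f : Functions k r} {C : ℝ} (hC : 0 ≤ C)
    (h : ∀ t, ‖coeff t f‖ * weight r t ≤ C) : ‖f‖ ≤ C := Real.iSup_le h hC

theorem continuous_coeff (t : Fin n →₀ ℕ) : Continuous (coeff t : Functions k r → k) :=
  AddMonoidHomClass.continuous_of_bound (coeff t : Functions k r →ₗ[k] k) (weight r t)⁻¹
    fun f => by
      rw [inv_mul_eq_div, le_div_iff₀ (weight_pos r t)]
      exact norm_coeff_mul_weight_le f t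

/-- Coefficients of a Cauchy sequence converge uniformly against the weights, and a uniform limit of
families tending to `0` tends to `0`, so the coefficientwise limit is again a restricted series. -/
instance [CompleteSpace k] : CompleteSpace (Functions k r) := by
  refine Metric.complete_of_cauchySeq_tendsto fun u hu => ?_
  have hc : ∀ t, ∃ a, Tendsto (fun N => coeff t (u N)) atTop (𝓝 a) := fun t => by
    refine cauchySeq_tendsto_of_complete (Metric.cauchySeq_iff'.2 fun ε hε => ?_)
    obtain ⟨N, hN⟩ := Metric.cauchySeq_iff'.1 hu (ε * weight r t) (mul_pos hε (weight_pos r t))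
    refine ⟨N, fun M hM => ?_⟩
    have h := hN M hM
    rw [dist_eq_norm] at h ⊢
    rw [← map_sub]
    exact lt_of_mul_lt_mul_right ((norm_coeff_mul_weight_le _ t).trans_lt h) (weight_pos r t).le
  choose a ha using hc
  have unif : ∀ ε > 0, ∃ N, ∀ M ≥ N, ∀ t, ‖coeff t (u M) - a t‖ * weight r t ≤ ε := by
    intro ε hε
    obtain ⟨N, hN⟩ := Metric.cauchySeq_iff.1 hu ε hε
    refine ⟨N, fun M hM t => ?_⟩
    refine le_of_tendsto (((tendsto_const_nhds.sub (ha t)).norm).mul_const (weight r t)) ?_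
    filter_upwards [eventually_ge_atTop N] with K hK
    have h := hN M hM K hK
    rw [dist_eq_norm] at h
    rw [← map_sub]
    exact (norm_coeff_mul_weight_le _ t).trans h.le
  have hmem : Tendsto (fun t => ‖a t‖ * weight r t) cofinite (𝓝 0) := by
    rw [Metric.tendsto_nhds]
    intro ε hε
    obtain ⟨N, hN⟩ := unif (ε / 2) (half_pos hε)
    filter_upwards [(tendsto_coeff (u N)).eventually_lt_const (half_pos hε)] with t ht
    have h1 := hN N le_rfl t
    rw [Real.dist_0_eq_abs, abs_of_nonneg (mul_nonneg (norm_nonneg _) (weight_pos r t).le)]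
    have h2 : ‖a t‖ ≤ ‖coeff t (u N)‖ + ‖coeff t (u N) - a t‖ := by
      calc ‖a t‖ = ‖coeff t (u N) - (coeff t (u N) - a t)‖ := by rw [sub_sub_cancel]
        _ ≤ _ := norm_sub_le _ _
    calc ‖a t‖ * weight r t ≤ (‖coeff t (u N)‖ + ‖coeff t (u N) - a t‖) * weight r t :=
          mul_le_mul_of_nonneg_right h2 (weight_pos r t).le
      _ < ε := by rw [add_mul]; linarith
  let F : Functions k r := ⟨fun t => a t, hmem⟩
  refine ⟨F, Metric.tendsto_atTop.2 fun ε hε => ?_⟩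
  obtain ⟨N, hN⟩ := unif (ε / 2) (half_pos hε)
  refine ⟨N, fun M hM => ?_⟩
  rw [dist_eq_norm]
  refine (norm_le (half_pos hε).le fun t => ?_).trans_lt (half_lt_self hε)
  rw [map_sub]
  exact hN M hM t

/-- The Gauss point of the polydisc. -/
def gaussPoint (r : Fin n → PosReal) : Space k r where
  toFun := gaussNorm
  map_zero' := gaussNorm_eq_zero.2 rfl
  add_le' := (gaussRingNorm r).add_le'
  neg' := (gaussRingNorm r).neg'
  map_one' := norm_one (α := Functions k r)
  map_mul' := gaussNorm_mul
  le_gaussNorm' _ := le_rfl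
  add_le_max' := gaussNorm_add_le_max

/-- Points are bounded by the Gauss norm by definition, and the Gauss point attains the bound. -/
theorem spectralNorm_eq_norm (f : Functions k r) : spectralNorm k r f = ‖f‖ :=
  le_antisymm (Real.iSup_le (fun x => x.le_gaussNorm' f) (norm_nonneg f))
    (le_ciSup (bddAbove_absAt f) (gaussPoint r))

end Functions

end Polydisc

namespace Polydisc

open Filter Topology

variable {k : Type*} [NormedField k] [IsUltrametricDist k] {n m : ℕ}

/-! ### Substitution -/

/-- The power product `∏ x_i ^ t_i`. -/
def powerProd {A : Type*} [CommMonoid A] (x : Fin n → A) (t : Fin n →₀ ℕ) : A := ∏ i, x i ^ t i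

section powerProd

variable {A : Type*} [CommMonoid A] (x : Fin n → A)

theorem powerProd_zero : powerProd x 0 = 1 := by simp [powerProd]

theorem powerProd_add (t u : Fin n →₀ ℕ) :
    powerProd x (t + u) = powerProd x t * powerProd x u := by
  simp [powerProd, pow_add, Finset.prod_mul_distrib]

theorem powerProd_single (i : Fin n) : powerProd x (Finsupp.single i 1) = x i := by
  rw [powerProd, Finset.prod_eq_single i]
  · simp
  · intro j _ hj
    simp [Finsupp.single_eq_of_ne hj]
  · simp

theorem map_powerProd {B F : Type*} [CommMonoid B] [FunLike F A B] [MonoidHomClass F A B]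
    (φ : F) (t : Fin n →₀ ℕ) : φ (powerProd x t) = powerProd (fun i => φ (x i)) t := by
  simp [powerProd]

end powerProd

/-! ### Ultrametric estimates for power products -/

section norms

variable {A : Type*} [NormedCommRing A] [NormOneClass A]

theorem norm_powerProd_le {x : Fin n → A} {s : Fin n → PosReal} (hx : ∀ i, ‖x i‖ ≤ s i)
    (t : Fin n →₀ ℕ) : ‖powerProd x t‖ ≤ weight s t := by
  rw [weight_eq_prod]
  refine (Finset.norm_prod_le _ _).trans (Finset.prod_le_prod (fun i _ => norm_nonneg _) ?_)
  intro i _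
  exact (norm_pow_le _ _).trans (pow_le_pow_left₀ (norm_nonneg _) (hx i) _)

variable [IsUltrametricDist A]

/-- The errors are relative to the bounds `ρ`, `σ`. Since the norm is ultrametric, the relative
error `ε` does not grow under multiplication, so one `ε` serves for monomials of every degree. -/
theorem norm_mul_sub_mul_le {A : Type*} [NormedCommRing A] [IsUltrametricDist A] {a b c d : A} {ρ σ ε : ℝ} (ha : ‖a‖ ≤ ρ) (hd : ‖d‖ ≤ σ)
    (hac : ‖a - c‖ ≤ ε * ρ) (hbd : ‖b - d‖ ≤ ε * σ) : ‖a * b - c * d‖ ≤ ε * (ρ * σ) := by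
  have h : a * b - c * d = a * (b - d) + (a - c) * d := by ring
  rw [h]
  refine (IsUltrametricDist.norm_add_le_max _ _).trans (max_le ?_ ?_)
  · calc _ ≤ ‖a‖ * ‖b - d‖ := norm_mul_le _ _
      _ ≤ ρ * (ε * σ) :=
          mul_le_mul ha hbd (norm_nonneg _) ((norm_nonneg _).trans ha)
      _ = _ := by ring
  · calc _ ≤ ‖a - c‖ * ‖d‖ := norm_mul_le _ _
      _ ≤ (ε * ρ) * σ :=
          mul_le_mul hac hd (norm_nonneg _) ((norm_nonneg _).trans hac)
      _ = _ := by ring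

theorem norm_pow_sub_pow_le {a c : A} {ρ ε : ℝ} (hε : 0 ≤ ε) (ha : ‖a‖ ≤ ρ) (hc : ‖c‖ ≤ ρ)
    (hac : ‖a - c‖ ≤ ε * ρ) (N : ℕ) : ‖a ^ N - c ^ N‖ ≤ ε * ρ ^ N := by
  induction N with
  | zero => simpa using hε
  | succ N ih =>
    rw [pow_succ', pow_succ', pow_succ']
    exact norm_mul_sub_mul_le ha
      ((norm_pow_le _ _).trans (pow_le_pow_left₀ (norm_nonneg _) hc _)) hac ih

theorem norm_powerProd_sub_powerProd_le {x y : Fin n → A} {s : Fin n → PosReal} {ε : ℝ}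
    (hε : 0 ≤ ε) (hx : ∀ i, ‖x i‖ ≤ s i) (hy : ∀ i, ‖y i‖ ≤ s i)
    (hxy : ∀ i, ‖x i - y i‖ ≤ ε * s i) (t : Fin n →₀ ℕ) :
    ‖powerProd x t - powerProd y t‖ ≤ ε * weight s t := by
  rw [weight_eq_prod, powerProd, powerProd]
  induction (Finset.univ : Finset (Fin n)) using Finset.induction_on with
  | empty => simpa using hε
  | insert i u hi ih =>
    rw [Finset.prod_insert hi, Finset.prod_insert hi, Finset.prod_insert hi]
    refine norm_mul_sub_mul_le ((norm_pow_le _ _).trans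
      (pow_le_pow_left₀ (norm_nonneg _) (hx i) _)) ?_
      (norm_pow_sub_pow_le hε (hx i) (hy i) (hxy i) _) ih
    refine (Finset.norm_prod_le _ _).trans (Finset.prod_le_prod (fun i _ => norm_nonneg _) ?_)
    intro j _
    exact (norm_pow_le _ _).trans (pow_le_pow_left₀ (norm_nonneg _) (hy j) _)

end norms

namespace Functions

variable {r : Fin n → PosReal} {s : Fin m → PosReal}

theorem coe_powerProd_coordinate (t : Fin n →₀ ℕ) :
    ((powerProd (coordinate k r) t : Functions k r) : MvPowerSeries (Fin n) k) =
      MvPowerSeries.monomial t 1 := by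
  have h : ((powerProd (coordinate k r) t : Functions k r) : MvPowerSeries (Fin n) k) =
      powerProd (fun i => (MvPowerSeries.X i : MvPowerSeries (Fin n) k)) t :=
    map_powerProd (coordinate k r) (Functions k r).val t
  rw [h, MvPowerSeries.monomial_one_eq, powerProd, Finsupp.prod_fintype _ _ fun _ => pow_zero _]

theorem coeff_powerProd_coordinate (t u : Fin n →₀ ℕ) [Decidable (u = t)] :
    coeff u (powerProd (coordinate k r) t) = if u = t then 1 else 0 := by
  classical
  rw [coeff_apply, coe_powerProd_coordinate, MvPowerSeries.coeff_monomial]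
  congr

theorem norm_coordinate_le (i : Fin n) : ‖coordinate k r i‖ ≤ r i := by
  classical
  refine norm_le (r i).2.le fun t => ?_
  rw [← powerProd_single (coordinate k r) i, coeff_powerProd_coordinate]
  split_ifs with h
  · simp [h, weight_single]
  · simpa using (r i).2.le

theorem norm_coordinate (i : Fin n) : ‖coordinate k r i‖ = r i := by
  classical
  refine le_antisymm (norm_coordinate_le i) ?_
  have := norm_coeff_mul_weight_le (coordinate k r i) (Finsupp.single i 1)
  rw [← powerProd_single (coordinate k r) i, coeff_powerProd_coordinate] at this
  simpa [weight_single, powerProd_single] using this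

/-- Used with `C = 1` to bound a substitution and with `C = ε` to compare it with the identity. -/
theorem norm_coeff_smul_le (g : Functions k s) {F : (Fin m →₀ ℕ) → Functions k r} {C : ℝ}
    (hC : 0 ≤ C) (hF : ∀ t, ‖F t‖ ≤ C * weight s t) (t : Fin m →₀ ℕ) :
    ‖coeff t g • F t‖ ≤ C * ‖g‖ := by
  rw [norm_smul_eq]
  calc _ ≤ ‖coeff t g‖ * (C * weight s t) := mul_le_mul_of_nonneg_left (hF t) (norm_nonneg _)
    _ = C * (‖coeff t g‖ * weight s t) := by ring
    _ ≤ _ := mul_le_mul_of_nonneg_left (norm_coeff_mul_weight_le g t) hC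

theorem continuous_of_norm_le {φ : Functions k s →ₐ[k] Functions k r} {C : ℝ}
    (h : ∀ g, ‖φ g‖ ≤ C * ‖g‖) : Continuous φ :=
  AddMonoidHomClass.continuous_of_bound φ C h

/-- An endomorphism that is close to the identity is isometric. -/
theorem norm_eq_of_norm_sub_le (u : Functions k r →ₐ[k] Functions k r) {ε : ℝ}
    (hε' : ε < 1) (h : ∀ g, ‖u g - g‖ ≤ ε * ‖g‖) (g : Functions k r) : ‖u g‖ = ‖g‖ := by
  rcases eq_or_ne g 0 with rfl | hg
  · simp
  have hlt : ‖u g - g‖ < ‖g‖ :=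
    (h g).trans_lt (mul_lt_of_lt_one_left (norm_pos_iff.2 hg) hε')
  -- Write `u g` as `(u g - g) + g`, a sum of terms of different norms.
  have := IsUltrametricDist.norm_add_eq_max_of_norm_ne_norm hlt.ne
  rwa [sub_add_cancel, max_eq_right hlt.le] at this

variable [CompleteSpace k]

theorem summable_coeff_smul (g : Functions k s) {F : (Fin m →₀ ℕ) → Functions k r} {C : ℝ}
    (hF : ∀ t, ‖F t‖ ≤ C * weight s t) : Summable fun t => coeff t g • F t := by
  refine NonarchimedeanAddGroup.summable_of_tendsto_cofinite_zero ?_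
  refine squeeze_zero_norm (fun t => ?_) (by simpa using (tendsto_coeff g).const_mul C)
  rw [norm_smul_eq]
  calc _ ≤ ‖coeff t g‖ * (C * weight s t) := mul_le_mul_of_nonneg_left (hF t) (norm_nonneg _)
    _ = _ := by ring

theorem hasSum_coeff_smul_powerProd_coordinate (g : Functions k r) :
    HasSum (fun t => coeff t g • powerProd (coordinate k r) t) g := by
  classical
  have hs : Summable fun t => coeff t g • powerProd (coordinate k r) t :=
    summable_coeff_smul (C := 1) g fun t => by
      simpa using norm_powerProd_le (norm_coordinate_le (k := k) (r := r)) t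
  convert hs.hasSum using 1
  refine ext_coeff fun u => ?_
  -- Coefficients are continuous, so the sum can be identified one coefficient at a time.
  have h := hs.hasSum.map (coeff u : Functions k r →ₗ[k] k) (continuous_coeff u)
  refine HasSum.unique ?_ h
  convert hasSum_ite_eq u (coeff u g) using 1
  funext t
  simp only [Function.comp_apply, map_smul, coeff_powerProd_coordinate, smul_eq_mul, mul_ite,
    mul_one, mul_zero]
  by_cases htu : t = u
  · simp [htu]
  · simp [htu, Ne.symm htu]

/-- Bounded algebra homomorphisms agreeing on the coordinates are equal. -/
theorem algHom_ext_of_continuous {φ ψ : Functions k s →ₐ[k] Functions k r} (hφ : Continuous φ)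
    (hψ : Continuous ψ) (h : ∀ i, φ (coordinate k s i) = ψ (coordinate k s i)) : φ = ψ := by
  refine AlgHom.ext fun g => ?_
  have h1 := (hasSum_coeff_smul_powerProd_coordinate g).map φ hφ
  have h2 := (hasSum_coeff_smul_powerProd_coordinate g).map ψ hψ
  refine h1.unique ?_
  convert h2 using 1
  funext t
  simp only [Function.comp_apply, map_smul, map_powerProd, h]

variable (f : Fin m → Functions k r)

theorem summable_subst (hf : ∀ i, ‖f i‖ ≤ s i) (g : Functions k s) : Summable fun t => coeff t g • powerProd f t :=
  summable_coeff_smul (C := 1) g fun t => by simpa using norm_powerProd_le hf t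

/-- No absolute convergence is needed: in an ultrametric ring the products of two summable families
form a summable family. -/
theorem tsum_mul_tsum_eq_tsum_sum_antidiagonal {A ι : Type*} [NormedCommRing A]
    [IsUltrametricDist A] [AddCommMonoid ι] [Finset.HasAntidiagonal ι] {x y : ι → A}
    (hx : Summable x) (hy : Summable y) : (∑' t, x t) * ∑' t, y t =
      ∑' t, ∑ p ∈ Finset.HasAntidiagonal.antidiagonal t, x p.1 * y p.2 :=
  have : NonarchimedeanRing A := ⟨NonarchimedeanAddGroup.is_nonarchimedean⟩
  hx.tsum_mul_tsum_eq_tsum_sum_antidiagonal hy (hx.mul_of_nonarchimedean hy)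

theorem subst_mul (hf : ∀ i, ‖f i‖ ≤ s i) (g h : Functions k s) :
    ∑' t, coeff t (g * h) • powerProd f t =
      (∑' t, coeff t g • powerProd f t) * ∑' t, coeff t h • powerProd f t := by
  classical
  refine Eq.trans ?_ (tsum_mul_tsum_eq_tsum_sum_antidiagonal (summable_subst f hf g)
    (summable_subst f hf h)).symm
  refine tsum_congr fun t => ?_
  rw [coeff_mul, Finset.sum_smul]
  refine Finset.sum_congr rfl fun p hp => ?_
  rw [← Finset.HasAntidiagonal.mem_antidiagonal.1 hp, powerProd_add, smul_mul_smul_comm]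

/-- Substitution of functions `f_i` with `‖f_i‖ ≤ s_i` in the analytic functions on the polydisc
of polyradius `s`. -/
def subst (hf : ∀ i, ‖f i‖ ≤ s i) : Functions k s →ₐ[k] Functions k r where
  toFun g := ∑' t, coeff t g • powerProd f t
  map_one' := by
    rw [← map_one (algebraMap k (Functions k s)), tsum_eq_single 0]
    · rw [coeff_algebraMap, if_pos rfl, powerProd_zero, one_smul]
    · intro t ht
      rw [coeff_algebraMap, if_neg ht, zero_smul]
  map_zero' := by simp
  map_mul' := subst_mul f hf
  map_add' g h := by
    simp only [map_add, add_smul]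
    exact (summable_subst f hf g).tsum_add (summable_subst f hf h)
  commutes' a := by
    rw [tsum_eq_single 0]
    · rw [coeff_algebraMap, if_pos rfl, powerProd_zero, Algebra.algebraMap_eq_smul_one]
    · intro t ht
      rw [coeff_algebraMap, if_neg ht, zero_smul]

theorem subst_apply (hf : ∀ i, ‖f i‖ ≤ s i) (g : Functions k s) : subst f hf g = ∑' t, coeff t g • powerProd f t := rfl

theorem subst_coordinate (hf : ∀ i, ‖f i‖ ≤ s i) (i : Fin m) : subst f hf (coordinate k s i) = f i := by
  classical
  rw [subst_apply, tsum_eq_single (Finsupp.single i 1), ← powerProd_single (coordinate k s) i,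
    coeff_powerProd_coordinate]
  · simp [powerProd_single]
  · intro t ht
    rw [← powerProd_single (coordinate k s) i, coeff_powerProd_coordinate, if_neg ht, zero_smul]

theorem norm_subst_le (hf : ∀ i, ‖f i‖ ≤ s i) (g : Functions k s) : ‖subst f hf g‖ ≤ ‖g‖ := by
  rw [subst_apply]
  refine IsUltrametricDist.norm_tsum_le_of_forall_le_of_nonneg (norm_nonneg g) fun t => ?_
  simpa using norm_coeff_smul_le (C := 1) g zero_le_one
    (fun t => by simpa using norm_powerProd_le hf t) t

/-- Expanding `g` in the coordinates turns the difference into `∑ g_t (f^t - T^t)`, whose terms are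
all bounded by `ε ‖g‖`. -/
theorem norm_subst_sub_le {s : Fin n → PosReal} (f : Fin n → Functions k s)
    (hf : ∀ i, ‖f i‖ ≤ s i) {ε : ℝ} (hε : 0 ≤ ε)
    (h : ∀ i, ‖f i - coordinate k s i‖ ≤ ε * s i) (g : Functions k s) :
    ‖subst f hf g - g‖ ≤ ε * ‖g‖ := by
  have h1 := (summable_subst f hf g).hasSum.sub (hasSum_coeff_smul_powerProd_coordinate g)
  simp only [← smul_sub] at h1
  rw [subst_apply, ← h1.tsum_eq]
  exact IsUltrametricDist.norm_tsum_le_of_forall_le_of_nonneg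
    (mul_nonneg hε (norm_nonneg g)) <| norm_coeff_smul_le g hε <|
      norm_powerProd_sub_powerProd_le hε hf norm_coordinate_le h

/-- An endomorphism that is close to the identity is surjective. -/
theorem surjective_of_norm_sub_le (u : Functions k r →ₐ[k] Functions k r) {ε : ℝ} (hε : 0 ≤ ε)
    (hε' : ε < 1) (h : ∀ g, ‖u g - g‖ ≤ ε * ‖g‖) : Function.Surjective u := by
  intro y
  -- A fixed point of this map is a solution of `u g = y`.
  have hc : ContractingWith ⟨ε, hε⟩ fun g => y - (u g - g) := by
    refine ⟨hε', LipschitzWith.of_dist_le_mul fun a b => ?_⟩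
    rw [dist_eq_norm, dist_eq_norm]
    have : y - (u a - a) - (y - (u b - b)) = -(u (a - b) - (a - b)) := by
      rw [map_sub]; ring
    rw [this, norm_neg]
    exact h _
  have := hc.fixedPoint_isFixedPt
  refine ⟨hc.fixedPoint, ?_⟩
  have h2 : y - (u hc.fixedPoint - hc.fixedPoint) = hc.fixedPoint := this
  rw [sub_sub_eq_add_sub, sub_eq_iff_eq_add, add_comm] at h2
  exact (add_left_cancel h2).symm

end Functions

/-! ### Morphisms and their pullbacks -/

namespace Hom

variable {r : Fin n → PosReal} {s : Fin m → PosReal}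

/-- The morphism attached to a norm-nonincreasing algebra homomorphism. -/
def ofAlgHom (φ : Functions k s →ₐ[k] Functions k r) (h : ∀ g, ‖φ g‖ ≤ ‖g‖) : Hom k r s where
  toFun x :=
    { toFun := fun g => absAt x (φ g)
      map_zero' := by rw [map_zero]; exact x.map_zero'
      add_le' := fun f g => by rw [map_add]; exact x.add_le' _ _
      neg' := fun f => by rw [map_neg]; exact x.neg' _
      map_one' := by rw [map_one]; exact x.map_one'
      map_mul' := fun f g => by rw [map_mul]; exact x.map_mul' _ _
      le_gaussNorm' := fun g => (x.le_gaussNorm' _).trans (h g)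
      add_le_max' := fun f g => by rw [map_add]; exact x.add_le_max' _ _ }
  pullback := φ
  continuous_toFun := by
    refine continuous_induced_rng.2 (continuous_pi fun g => ?_)
    exact (continuous_apply (φ g)).comp continuous_induced_dom
  bounded := ⟨1, fun g => by rw [one_mul]; exact h g⟩
  absAt_toFun _ _ := rfl

theorem space_ext {x y : Space k r} (h : ∀ g, absAt x g = absAt y g) : x = y := by
  obtain ⟨x, _, _⟩ := x
  obtain ⟨y, _, _⟩ := y
  congr
  exact DFunLike.ext _ _ h

/-- A point is its seminorm, so `absAt_toFun` recovers the map on points from the pullback.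
Identities of morphisms thus reduce to identities of algebra homomorphisms. -/
theorem ext_pullback {φ ψ : Hom k r s} (h : φ.pullback = ψ.pullback) : φ = ψ :=
  Hom.ext (funext fun x => space_ext fun g => by
    rw [φ.absAt_toFun, ψ.absAt_toFun, h]) h

theorem continuous_pullback (φ : Hom k r s) : Continuous φ.pullback := by
  obtain ⟨C, hC⟩ := φ.bounded
  exact Functions.continuous_of_norm_le hC

end Hom

end Polydisc

namespace Polydisc

/-! ### Graded residues -/

namespace NonarchSeminorm

variable {A B : Type*} [CommRing A] [CommRing B]

theorem coe_reesSingle (N : NonarchSeminorm A) {ρ : PosReal} {a : A} (h : N a ≤ ρ) :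
    (N.reesSingle ρ a h : MonoidAlgebra A PosReal) = MonoidAlgebra.single ρ a := rfl

theorem coeff_single_lt (N : NonarchSeminorm A) {ρ : PosReal} {a : A} (h : N a < ρ)
    (σ : PosReal) : N ((MonoidAlgebra.single ρ a).coeff σ) < σ := by
  classical
  rw [MonoidAlgebra.coeff_single, Finsupp.single_apply]
  split_ifs with h1
  · rwa [← h1]
  · exact N.map_zero'.trans_lt σ.2

/-- The difference of the representatives is concentrated in degree `ρ`, so membership in
`reesIdeal` is a condition in that degree alone. -/
theorem residue_eq_residue_iff (N : NonarchSeminorm A) {ρ : PosReal} {a b : A} (ha : N a ≤ ρ)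
    (hb : N b ≤ ρ) : N.residue ρ a ha = N.residue ρ b hb ↔ N (a - b) < ρ := by
  refine Ideal.Quotient.eq.trans ?_
  have key : ((N.reesSingle ρ a ha - N.reesSingle ρ b hb : N.rees) : MonoidAlgebra A PosReal) =
      MonoidAlgebra.single ρ (a - b) := by
    rw [AddSubgroupClass.coe_sub, coe_reesSingle, coe_reesSingle, MonoidAlgebra.single_sub]
  constructor
  · intro h
    have := h ρ
    rwa [key, MonoidAlgebra.coeff_single, Finsupp.single_eq_same] at this
  · intro h σ
    rw [key]
    exact N.coeff_single_lt h σ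

theorem residue_add (N : NonarchSeminorm A) {ρ : PosReal} {a b : A} (ha : N a ≤ ρ)
    (hb : N b ≤ ρ) (hab : N (a + b) ≤ ρ) :
    N.residue ρ (a + b) hab = N.residue ρ a ha + N.residue ρ b hb := by
  rw [residue, residue, residue, ← map_add]
  congr 1
  exact Subtype.ext (MonoidAlgebra.single_add ρ a b)

/-- The degree `τ` is kept free so that `σ / r j * r j = σ` applies without rewriting inside the
dependent norm bounds. -/
theorem residue_mul (N : NonarchSeminorm A) {ρ σ τ : PosReal} (hτ : ρ * σ = τ) {a b : A}
    (ha : N a ≤ ρ) (hb : N b ≤ σ) (hab : N (a * b) ≤ τ) :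
    N.residue τ (a * b) hab = N.residue ρ a ha * N.residue σ b hb := by
  rw [residue, residue, residue, ← map_mul]
  congr 1
  subst hτ
  exact Subtype.ext (MonoidAlgebra.single_mul_single ..).symm

theorem sum_le (N : NonarchSeminorm A) {ι : Type*} (t : Finset ι) {F : ι → A} {ρ : ℝ}
    (hρ : 0 ≤ ρ) (hF : ∀ i, N (F i) ≤ ρ) : N (∑ i ∈ t, F i) ≤ ρ := by
  classical
  induction t using Finset.induction_on with
  | empty => exact N.map_zero'.trans_le hρ
  | insert i t hi ih =>
    rw [Finset.sum_insert hi]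
    exact (N.add_le_max' _ _).trans (max_le (hF i) ih)

theorem residue_sum (N : NonarchSeminorm A) {ι : Type*} (t : Finset ι) {ρ : PosReal} {F : ι → A}
    (hF : ∀ i, N (F i) ≤ ρ) (h : N (∑ i ∈ t, F i) ≤ ρ) :
    N.residue ρ (∑ i ∈ t, F i) h = ∑ i ∈ t, N.residue ρ (F i) (hF i) := by
  simp only [residue, ← map_sum]
  congr 1
  refine Subtype.ext ?_
  rw [AddSubmonoidClass.coe_finsetSum]
  exact map_sum (MonoidAlgebra.singleAddHom ρ) F t

theorem reduce_eq_residue (N : NonarchSeminorm A) {ρ : PosReal} {a : A} (h : (ρ : ℝ) = N a) :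
    N.reduce a = N.residue ρ a h.ge := by
  have hpos : 0 < N a := h ▸ ρ.2
  have hρ : ρ = ⟨N a, hpos⟩ := Subtype.ext h
  subst hρ
  exact dif_pos hpos

theorem reductionMap_residue (N : NonarchSeminorm A) (M : NonarchSeminorm B) (φ : A →+* B)
    (h : ∀ a, M (φ a) ≤ N a) {ρ : PosReal} {a : A} (ha : N a ≤ ρ) :
    reductionMap N M φ h (N.residue ρ a ha) = M.residue ρ (φ a) ((h a).trans ha) := by
  refine (Ideal.quotientMap_mk ..).trans ?_
  refine congrArg M.toReduction (Subtype.ext ?_)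
  exact MonoidAlgebra.mapRingHom_single ..

variable {n : ℕ}

/-- The matrix over the Rees ring with entries `a_ij` in degree `s_i / r_j`. -/
def reesMatrix (N : NonarchSeminorm A) {s r : Fin n → PosReal} {a : Matrix (Fin n) (Fin n) A}
    (ha : ∀ i j, N (a i j) ≤ (s i / r j : PosReal)) : Matrix (Fin n) (Fin n) N.rees :=
  Matrix.of fun i j => N.reesSingle (s i / r j) (a i j) (ha i j)

/-- In the group ring the homogeneous matrix is `diag(s) * a * diag(r⁻¹)`, so its determinant is
that of `a` shifted in degree by `∏ s_i / ∏ r_j`. -/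
theorem coe_det_reesMatrix (N : NonarchSeminorm A) {s r : Fin n → PosReal}
    {a : Matrix (Fin n) (Fin n) A} (ha : ∀ i j, N (a i j) ≤ (s i / r j : PosReal)) :
    ((N.reesMatrix ha).det : MonoidAlgebra A PosReal) =
      MonoidAlgebra.single ((∏ i, s i) / ∏ j, r j) a.det := by
  have h : N.rees.subtype.mapMatrix (N.reesMatrix ha) =
      Matrix.diagonal (fun i => MonoidAlgebra.of A PosReal (s i)) *
        (MonoidAlgebra.singleOneRingHom : A →+* MonoidAlgebra A PosReal).mapMatrix a *
        Matrix.diagonal (fun j => MonoidAlgebra.of A PosReal (r j)⁻¹) := by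
    ext1 i j
    rw [Matrix.mul_diagonal, Matrix.diagonal_mul]
    change MonoidAlgebra.single (s i / r j) (a i j) =
      MonoidAlgebra.single (s i) 1 * MonoidAlgebra.single 1 (a i j) *
        MonoidAlgebra.single (r j)⁻¹ 1
    rw [MonoidAlgebra.single_mul_single, MonoidAlgebra.single_mul_single, mul_one, one_mul,
      mul_one, div_eq_mul_inv]
  have h2 := congrArg Matrix.det h
  rw [← RingHom.map_det, Matrix.det_mul, Matrix.det_mul, Matrix.det_diagonal,
    Matrix.det_diagonal, ← RingHom.map_det, ← map_prod, ← map_prod] at h2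
  refine h2.trans ?_
  change MonoidAlgebra.single _ 1 * MonoidAlgebra.single 1 a.det * MonoidAlgebra.single _ 1 = _
  rw [MonoidAlgebra.single_mul_single, MonoidAlgebra.single_mul_single, mul_one, one_mul,
    mul_one, div_eq_mul_inv, Finset.prod_inv_distrib]

/-- A homogeneous matrix has a homogeneous determinant. -/
theorem det_le (N : NonarchSeminorm A) {s r : Fin n → PosReal}
    {a : Matrix (Fin n) (Fin n) A} (ha : ∀ i j, N (a i j) ≤ (s i / r j : PosReal)) :
    N a.det ≤ ((∏ i, s i) / ∏ j, r j : PosReal) := by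
  -- The determinant is formed inside the Rees ring, whose defining bound applies to its coefficient
  -- in this degree.
  have h := (N.reesMatrix ha).det.2 ((∏ i, s i) / ∏ j, r j)
  rwa [coe_det_reesMatrix, MonoidAlgebra.coeff_single, Finsupp.single_eq_same] at h

/-- Used contrapositively: a nonzero reduced determinant forces `a.det` to have the largest norm
that `det_le` allows. -/
theorem det_residue_eq_zero (N : NonarchSeminorm A) {s r : Fin n → PosReal}
    {a : Matrix (Fin n) (Fin n) A} (ha : ∀ i j, N (a i j) ≤ (s i / r j : PosReal))
    (h : N a.det < ((∏ i, s i) / ∏ j, r j : PosReal)) :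
    (Matrix.of fun i j => N.residue (s i / r j) (a i j) (ha i j)).det = 0 := by
  have h1 : (Matrix.of fun i j => N.residue (s i / r j) (a i j) (ha i j)) =
      N.toReduction.mapMatrix (N.reesMatrix ha) := rfl
  rw [h1, ← RingHom.map_det]
  refine Ideal.Quotient.eq_zero_iff_mem.2 fun σ => ?_
  rw [coe_det_reesMatrix]
  exact N.coeff_single_lt h σ

end NonarchSeminorm

/-! ### Inverting homogeneous matrices and lifting affine expressions -/

variable {k : Type*} [NormedField k] [IsUltrametricDist k] {n : ℕ}

open NonarchSeminorm

/-- The inverse of a homogeneous matrix with nonzero reduced determinant is homogeneous. -/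
theorem exists_inverse_matrix {s r : Fin n → PosReal} {a : Matrix (Fin n) (Fin n) k}
    (ha : ∀ i j, ‖a i j‖ ≤ (s i / r j : PosReal))
    (hdet : ((∏ i, s i) / ∏ j, r j : PosReal) ≤ ‖a.det‖) :
    ∃ b : Matrix (Fin n) (Fin n) k, a * b = 1 ∧ b * a = 1 ∧
      ∀ i j, ‖b i j‖ ≤ (r i / s j : PosReal) := by
  have hd0 : 0 < ‖a.det‖ := lt_of_lt_of_le (Subtype.prop _) hdet
  have hu : IsUnit a.det := isUnit_iff_ne_zero.2 (norm_pos_iff.1 hd0)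
  refine ⟨a⁻¹, a.mul_nonsing_inv hu, a.nonsing_inv_mul hu, fun i j => ?_⟩
  -- This entry is the determinant of `a` with row `j` replaced by the `i`-th unit vector. The new
  -- matrix is homogeneous once the row degree `s j` is replaced by `r i`, because the entry `1`
  -- then has degree `r i / r i`; so `det_le` applies.
  have hadj : ‖a.adjugate i j‖ ≤
      ((∏ l, Function.update s j (r i) l) / ∏ l, r l : PosReal) := by
    rw [Matrix.adjugate_apply]
    refine (absSeminorm k).det_le fun p q => ?_
    change ‖_‖ ≤ _
    rcases eq_or_ne p j with rfl | hp
    · rw [Matrix.updateRow_self, Function.update_self]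
      rcases eq_or_ne q i with rfl | hq
      · rw [Pi.single_eq_same, div_self', norm_one]
        exact le_rfl
      · rw [Pi.single_eq_of_ne hq, norm_zero]
        exact (Subtype.prop (r i / r q)).le
    · rw [Matrix.updateRow_ne hp, Function.update_of_ne hp]
      exact ha p q
  have hprod : ((∏ l, Function.update s j (r i) l) / ∏ l, r l : PosReal) =
      (r i / s j) * ((∏ l, s l) / ∏ l, r l) := by
    rw [Finset.prod_update_of_mem (Finset.mem_univ j),
      Finset.prod_eq_mul_prod_sdiff_singleton_of_mem (Finset.mem_univ j) s, ← mul_div_assoc,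
      ← mul_assoc, div_mul_cancel]
  rw [Matrix.inv_def, Matrix.smul_apply, smul_eq_mul, Ring.inverse_eq_inv', norm_mul, norm_inv,
    inv_mul_le_iff₀ hd0]
  refine hadj.trans ?_
  rw [hprod, mul_comm, Positive.val_mul]
  exact mul_le_mul_of_nonneg_right hdet (r i / s j).2.le

theorem algebraMap_residue (r : Fin n → PosReal) {ρ : PosReal} {a : k}
    (ha : absSeminorm k a ≤ ρ) :
    algebraMap (absSeminorm k).Reduction (spectralNorm k r).Reduction
      ((absSeminorm k).residue ρ a ha) =
    (spectralNorm k r).residue ρ (algebraMap k (Functions k r) a)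
      ((spectralNorm_algebraMap_le k r a).trans ha) :=
  reductionMap_residue ..

/-- An affine expression for the reductions lifts to an affine approximation. -/
theorem norm_sub_affine_lt {r : Fin n → PosReal} {σ : PosReal} {f : Functions k r}
    (hσ : (σ : ℝ) = spectralNorm k r f) {a : Fin n → k} {b : k}
    (ha : ∀ j, absSeminorm k (a j) ≤ (σ / r j : PosReal)) (hb : absSeminorm k b ≤ σ)
    (hf : (spectralNorm k r).reduce f =
      ∑ j, (absSeminorm k).residue (σ / r j) (a j) (ha j) •
        (spectralNorm k r).reduce (coordinate k r j) +
        algebraMap _ (spectralNorm k r).Reduction ((absSeminorm k).residue σ b hb)) :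
    ‖f - (∑ j, a j • coordinate k r j + algebraMap k (Functions k r) b)‖ < σ := by
  have hc : ∀ j, (r j : ℝ) = spectralNorm k r (coordinate k r j) := fun j => by
    rw [Functions.spectralNorm_eq_norm, Functions.norm_coordinate]
  have hterm : ∀ j, spectralNorm k r (a j • coordinate k r j) ≤ σ := fun j => by
    rw [Functions.spectralNorm_eq_norm, Functions.norm_smul_eq, Functions.norm_coordinate]
    have h1 : ((σ / r j : PosReal) : ℝ) * r j = σ := by
      rw [← Positive.val_mul, div_mul_cancel]
    rw [← h1]
    exact mul_le_mul_of_nonneg_right (ha j) (r j).2.le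
  have hsum := (spectralNorm k r).sum_le Finset.univ σ.2.le hterm
  have hb' := (spectralNorm_algebraMap_le k r b).trans hb
  have hall := ((spectralNorm k r).add_le_max' _ _).trans (max_le hsum hb')
  -- The strict inequality is equality of residues in degree `σ`, where both sides are compared term
  -- by term.
  rw [← Functions.spectralNorm_eq_norm, ← residue_eq_residue_iff _ hσ.ge hall,
    ← reduce_eq_residue _ hσ, hf, residue_add _ hsum hb', residue_sum _ _ hterm,
    algebraMap_residue]
  congr 1
  refine Finset.sum_congr rfl fun j _ => ?_
  rw [reduce_eq_residue _ (hc j), Algebra.smul_def, algebraMap_residue,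
    ← residue_mul _ (div_mul_cancel σ (r j)) _ _ (by rw [← Algebra.smul_def]; exact hterm j)]
  congr 1
  rw [Algebra.smul_def]

end Polydisc

namespace Polydisc

/-! ### Affine changes of coordinates and the main theorem -/

open NonarchSeminorm Functions

variable {k : Type*} [NormedField k] [IsUltrametricDist k] {n m : ℕ}

theorem norm_sub_le_max {A : Type*} [SeminormedAddCommGroup A] [IsUltrametricDist A] (x y : A) :
    ‖x - y‖ ≤ max ‖x‖ ‖y‖ := by
  simpa [sub_eq_add_neg] using IsUltrametricDist.norm_add_le_max x (-y)

theorem norm_sum_smul_le {r : Fin n → PosReal} {t : Fin m → PosReal} {ρ : PosReal} {a : Fin n → k}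
    {x : Fin n → Functions k t} (ha : ∀ j, ‖a j‖ ≤ (ρ / r j : PosReal))
    (hx : ∀ j, ‖x j‖ ≤ r j) : ‖∑ j, a j • x j‖ ≤ ρ := by
  refine IsUltrametricDist.norm_sum_le_of_forall_le_of_nonneg ρ.2.le fun j _ => ?_
  have h1 : ((ρ / r j : PosReal) : ℝ) * r j = ρ := by
    rw [← Positive.val_mul, div_mul_cancel]
  rw [norm_smul_eq, ← h1]
  exact mul_le_mul (ha j) (hx j) (norm_nonneg _) (Subtype.prop (ρ / r j)).le

theorem sum_smul_sum_smul_eq {R M : Type*} [CommRing R] [AddCommGroup M] [Module R M]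
    {a c : Matrix (Fin n) (Fin n) R} (h : a * c = 1) (x : Fin n → M) (i : Fin n) :
    ∑ j, a i j • ∑ l, c j l • x l = x i := by
  simp only [Finset.smul_sum, ← mul_smul]
  rw [Finset.sum_comm]
  simp only [← Finset.sum_smul, ← Matrix.mul_apply, h, Matrix.one_apply, ite_smul, one_smul,
    zero_smul, Finset.sum_ite_eq, Finset.mem_univ, if_true]

variable [CompleteSpace k]

/-- An invertible homogeneous affine change of coordinates is an isomorphism between the function
algebras that is norm-nonincreasing in both directions. -/
theorem exists_affine_inverse {r s : Fin n → PosReal} {a : Matrix (Fin n) (Fin n) k}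
    (ha : ∀ i j, ‖a i j‖ ≤ (s i / r j : PosReal))
    (hdet : ((∏ i, s i) / ∏ j, r j : PosReal) ≤ ‖a.det‖) {b : Fin n → k}
    (hb : ∀ i, ‖b i‖ ≤ s i) :
    ∃ (L : Functions k s →ₐ[k] Functions k r) (M : Functions k r →ₐ[k] Functions k s),
      (∀ i, L (coordinate k s i) =
        ∑ j, a i j • coordinate k r j + algebraMap k (Functions k r) (b i)) ∧
      (∀ g, ‖L g‖ ≤ ‖g‖) ∧ (∀ g, ‖M g‖ ≤ ‖g‖) ∧ (∀ g, L (M g) = g) ∧ ∀ g, M (L g) = g := by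
  obtain ⟨c, hac, hca, hc⟩ := exists_inverse_matrix ha hdet
  have hl : ∀ i, ‖∑ j, a i j • coordinate k r j + algebraMap k (Functions k r) (b i)‖ ≤ s i :=
    fun i => (IsUltrametricDist.norm_add_le_max _ _).trans <|
      max_le (norm_sum_smul_le (ha i) norm_coordinate_le) ((norm_algebraMap_eq _).trans_le (hb i))
  -- The inverse affine map is `T ↦ c (T - b)`; the bound `r i / s j` on the entries of `c` makes
  -- its substitution well defined.
  have hm : ∀ j, ‖∑ i, c j i • (coordinate k s i - algebraMap k (Functions k s) (b i))‖ ≤ r j :=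
    fun j => norm_sum_smul_le (hc j) fun i => (norm_sub_le_max _ _).trans <|
      max_le (norm_coordinate_le i) ((norm_algebraMap_eq _).trans_le (hb i))
  have hL := subst_coordinate _ hl
  have hM := subst_coordinate _ hm
  have hL' := norm_subst_le _ hl
  have hM' := norm_subst_le _ hm
  -- Only the values on coordinates and the norm bounds matter from here on.
  generalize subst _ hl = L at hL hL'
  generalize subst _ hm = M at hM hM'
  have hcL : Continuous L := continuous_of_norm_le (C := 1) (by simpa using hL')
  have hcM : Continuous M := continuous_of_norm_le (C := 1) (by simpa using hM')
  refine ⟨L, M, hL, hL', hM', ?_, ?_⟩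
  · refine DFunLike.congr_fun (f := L.comp M) (g := AlgHom.id k _)
      (algHom_ext_of_continuous (hcL.comp hcM) continuous_id fun j => ?_)
    rw [AlgHom.comp_apply, hM, AlgHom.id_apply]
    simp only [map_sum, map_smul, map_sub, hL, AlgHom.commutes, add_sub_cancel_right]
    exact sum_smul_sum_smul_eq hca _ _
  · refine DFunLike.congr_fun (f := M.comp L) (g := AlgHom.id k _)
      (algHom_ext_of_continuous (hcM.comp hcL) continuous_id fun i => ?_)
    rw [AlgHom.comp_apply, hL, AlgHom.id_apply]
    simp only [map_add, map_sum, map_smul, hM, AlgHom.commutes]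
    rw [sum_smul_sum_smul_eq hac, sub_add_cancel]

/-- A finite supremum of ratios `< 1` is `< 1`. Taking it in `NNReal` makes `ε` nonnegative and
gives `0` for the empty family, which covers `n = 0`. -/
theorem exists_uniform_ratio {s : Fin n → PosReal} {x : Fin n → ℝ} (hx : ∀ i, x i < s i) :
    ∃ ε : ℝ, 0 ≤ ε ∧ ε < 1 ∧ ∀ i, x i ≤ ε * s i := by
  refine ⟨(Finset.univ.sup fun i => Real.toNNReal (x i / s i) : NNReal), NNReal.coe_nonneg _,
    ?_, fun i => ?_⟩
  · rw [NNReal.coe_lt_one, Finset.sup_lt_iff (by simp)]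
    intro i _
    rw [Real.toNNReal_lt_one, div_lt_one (s i).2]
    exact hx i
  · rw [← div_le_iff₀ (s i).2]
    exact (Real.le_coe_toNNReal _).trans
      (NNReal.coe_le_coe.2 (Finset.le_sup (f := fun i => Real.toNNReal (x i / s i))
        (Finset.mem_univ i)))

/-- Functions close to an invertible homogeneous affine change of coordinates induce an isometric
isomorphism of function algebras. -/
theorem exists_subst_inverse {r s : Fin n → PosReal} {f : Fin n → Functions k r}
    (hs : ∀ i, ‖f i‖ ≤ s i) {a : Matrix (Fin n) (Fin n) k}
    (ha : ∀ i j, ‖a i j‖ ≤ (s i / r j : PosReal))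
    (hdet : ((∏ i, s i) / ∏ j, r j : PosReal) ≤ ‖a.det‖) {b : Fin n → k}
    (hb : ∀ i, ‖b i‖ ≤ s i)
    (hf : ∀ i, ‖f i - (∑ j, a i j • coordinate k r j + algebraMap k (Functions k r) (b i))‖ <
      s i) :
    ∃ ψ : Functions k r →ₐ[k] Functions k s, (∀ g, ‖ψ g‖ ≤ ‖g‖) ∧
      (∀ g, ψ (subst f hs g) = g) ∧ ∀ g, subst f hs (ψ g) = g := by
  obtain ⟨L, M, hL, hL', hM', hLM, hML⟩ := exists_affine_inverse ha hdet hb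
  have hMf : ∀ i, ‖M (f i)‖ ≤ s i := fun i => (hM' _).trans (hs i)
  obtain ⟨ε, hε, hε', hsub⟩ := exists_uniform_ratio
    (x := fun i => ‖M (f i) - coordinate k s i‖) (s := s) fun i => by
      -- `M` is contractive and sends the error `f i - L T_i` to `M (f i) - T_i`.
      have h := hM' (f i - L (coordinate k s i))
      rw [map_sub, hML] at h
      rw [hL] at h
      exact h.trans_lt (hf i)
  have hcM : Continuous M := continuous_of_norm_le (C := 1) (by simpa using hM')
  have hc : Continuous (subst f hs) :=
    continuous_of_norm_le (C := 1) (by simpa using norm_subst_le f hs)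
  have hc' : Continuous (subst _ hMf) :=
    continuous_of_norm_le (C := 1) (by simpa using norm_subst_le _ hMf)
  have hu : M.comp (subst f hs) = subst _ hMf :=
    algHom_ext_of_continuous (hcM.comp hc) hc' fun i => by
      rw [AlgHom.comp_apply, subst_coordinate, subst_coordinate]
  have hclose : ∀ g, ‖M (subst f hs g) - g‖ ≤ ε * ‖g‖ := fun g => by
    rw [← AlgHom.comp_apply, hu]
    exact norm_subst_sub_le _ hMf hε hsub g
  have hnorm : ∀ g, ‖subst f hs g‖ = ‖g‖ := fun g => by
    refine le_antisymm (norm_subst_le f hs g) ?_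
    -- Since the composite is isometric and `M` contractive, substitution of `f` cannot decrease
    -- norms.
    rw [← norm_eq_of_norm_sub_le (M.comp (subst f hs)) hε' hclose g]
    exact hM' _
  have hbij : Function.Bijective (subst f hs) := by
    constructor
    · exact (AddMonoidHomClass.isometry_of_norm _ hnorm).injective
    · intro y
      obtain ⟨x, hx⟩ := surjective_of_norm_sub_le (M.comp (subst f hs)) hε hε' hclose (M y)
      refine ⟨x, ?_⟩
      -- `M` is injective with left inverse `L`, so surjectivity passes from the composite to the
      -- substitution.
      rw [← hLM (subst f hs x), ← hLM y, ← hx, AlgHom.comp_apply]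
  let e := AlgEquiv.ofBijective (subst f hs) hbij
  have he : ∀ g, subst f hs (e.symm g) = g := e.apply_symm_apply
  refine ⟨e.symm.toAlgHom, fun g => ?_, e.symm_apply_apply, he⟩
  change ‖e.symm g‖ ≤ ‖g‖
  rw [← hnorm, he]

theorem inducesIso_of_close_to_affine {r s : Fin n → PosReal} {f : Fin n → Functions k r}
    (hs : ∀ i, ‖f i‖ ≤ s i) {a : Matrix (Fin n) (Fin n) k}
    (ha : ∀ i j, ‖a i j‖ ≤ (s i / r j : PosReal))
    (hdet : ((∏ i, s i) / ∏ j, r j : PosReal) ≤ ‖a.det‖) {b : Fin n → k}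
    (hb : ∀ i, ‖b i‖ ≤ s i)
    (hf : ∀ i, ‖f i - (∑ j, a i j • coordinate k r j + algebraMap k (Functions k r) (b i))‖ <
      s i) : InducesIso f s := by
  obtain ⟨ψ, hψ, hleft, hright⟩ := exists_subst_inverse hs ha hdet hb hf
  -- Pullback reverses composition, which is why `hright` proves the first identity and `hleft` the
  -- second.
  refine ⟨Hom.ofAlgHom (subst f hs) (norm_subst_le f hs), subst_coordinate f hs, fun χ hχ => ?_,
    Hom.ofAlgHom ψ hψ, Hom.ext_pullback (AlgHom.ext hright), Hom.ext_pullback (AlgHom.ext hleft)⟩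
  refine Hom.ext_pullback (algHom_ext_of_continuous χ.continuous_pullback
    (Hom.continuous_pullback _) fun i => ?_)
  exact (hχ i).trans (subst_coordinate f hs i).symm

end Polydisc

end

theorem mainTheorem6 {k : Type*} [NormedField k] [IsUltrametricDist k] [CompleteSpace k]
    {n : ℕ} (r s : Fin n → Polydisc.PosReal) (f : Fin n → Polydisc.Functions k r)
    (hs : ∀ i, (s i : ℝ) = Polydisc.spectralNorm k r (f i))
    (A : Matrix (Fin n) (Fin n) (Polydisc.absSeminorm k).Reduction)
    (hA : A ∈ (Polydisc.absSeminorm k).homogeneousGL s r)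
    (B : Fin n → (Polydisc.absSeminorm k).Reduction)
    (hB : ∀ i, B i ∈ (Polydisc.absSeminorm k).homogeneousPart (s i))
    (hf : ∀ i, (Polydisc.spectralNorm k r).reduce (f i) =
      ∑ j, A i j • (Polydisc.spectralNorm k r).reduce (Polydisc.coordinate k r j) +
        algebraMap _ (Polydisc.spectralNorm k r).Reduction (B i)) :
    Polydisc.IsCoordinateSystem f ∧ Polydisc.InducesIso f s := by
  suffices h : Polydisc.InducesIso f s from ⟨⟨s, h⟩, h⟩
  choose a ha hAa using hA.1
  choose b hb hBb using hB
  refine Polydisc.inducesIso_of_close_to_affine (a := Matrix.of a) (b := b)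
    (fun i => by rw [hs, Polydisc.Functions.spectralNorm_eq_norm]) ha ?_ hb fun i => ?_
  -- A determinant of smaller norm than its degree would have residue zero, against `det A ≠ 0`.
  · by_contra h
    refine hA.2 ?_
    have hAeq : A = Matrix.of fun i j =>
        (Polydisc.absSeminorm k).residue (s i / r j) (a i j) (ha i j) :=
      Matrix.ext fun i j => hAa i j
    rw [hAeq]
    exact (Polydisc.absSeminorm k).det_residue_eq_zero (a := Matrix.of a) ha (not_le.1 h)
  · refine Polydisc.norm_sub_affine_lt (hs i) (ha i) (hb i) ?_
    rw [hf, hBb]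
    simp only [hAa]
    rfl
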